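/- Let $K$ be an algebraically closed field, let $P\subset\mathbb{R}^m$ be an $m$-dimensional polytope whose vertices lie in $\mathbb{Z}^m$, let $S_P\subset\mathbb{Z}^m\times\mathbb{Z}$ be the semigroup generated by $(P\cap\mathbb{Z}^m)\times\{1\}$, and let $X_P=\operatorname{Proj}K[S_P]$, embedded in the projective space $\mathbb{P}$ over $K$ with homogeneous coordinates $x_u$, $u\in P\cap\mathbb{Z}^m$, via $x_u\mapsto\chi^{(u,1)}$. The torus $T=\operatorname{Spec}K[\mathbb{Z}^m]$ acts on $\mathbb{P}$ by $t\cdot(x_u)_u=(t^u x_u)_u$; this action preserves $X_P$ and hence induces an action on the Fano scheme $\mathbf{F}_k(X_P)$, the fine moduli space of $k$-planes of $\mathbb{P}$ contained in $X_P$ ($k\ge 0$). A primitive $k$-simplex is the convex hull of $k+1$ affinely independent points of $\mathbb{Z}^m$ that contains no other points of $\mathbb{Z}^m$. For a nonempty face $Q$ of $P$ (with $Q=P$ allowed) let $X_Q\subset X_P$ be the closure of the corresponding torus orbit, that is, of the $T$-orbit of the point of $\mathbb{P}$ with $x_u=1$ for $u\in Q$ and $x_u=0$ for $u\notin Q$.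 (1) For every $k\geq 0$, the faces $Q$ of $P$ that are primitive $k$-simplices are in bijection with the $T$-fixed $K$-points of $\mathbf{F}_k(X_P)$; the bijection sends $Q$ to the $k$-plane $X_Q$. (2) For every nonempty face $Q$ of $P$, the orbit closure $X_Q$ is a linear subspace of $\mathbb{P}$ if and only if $Q$ is a primitive $d$-simplex for some $d\ge 0$; more precisely, for every $d\geq 0$, $X_Q$ is a $d$-dimensional linear subspace of $\mathbb{P}$ if and only if $Q$ is a primitive $d$-simplex. -/

import Mathlib

open CategoryTheory

universe u

namespace ToricFano

/-! ### Projective space, linear subspaces and the Fano scheme -/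

section Fano

variable {K : Type u} [Field K] {ι : Type}

/-- The base change of a submodule `M ⊆ R^ι` along `φ : R → S`: the `S`-submodule of `S^ι`
spanned by the image of `M`. -/
def baseChange {R S : Type u} [CommRing R] [CommRing S] (φ : R →+* S)
    (M : Submodule R (ι → R)) : Submodule S (ι → S) :=
  Submodule.span S ((fun v i => φ (v i)) '' (M : Set (ι → R)))

/-- An `R`-valued point of the Fano scheme `F_k(X)` of the closed subscheme `X = V(I)` of the
projective space over `K` with homogeneous coordinates `x_i`, `i ∈ ι` (`I` a homogeneous ideal):
a family over `Spec R` of `k`-planes contained in `X`, i.e. a direct summand `M` of `R^ι` of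
constant rank `k + 1` all of whose points, over all `R`-algebras `S`, are zeros of `I`. -/
@[ext]
structure FanoPoint (I : Ideal (MvPolynomial ι K)) (k : ℕ) (R : Type u) [CommRing R]
    [Algebra K R] where
  toSubmodule : Submodule R (ι → R)
  isComplemented : IsComplemented toSubmodule
  rank_eq : ∀ p : PrimeSpectrum R, Module.rankAtStalk toSubmodule p = k + 1
  vanishing : ∀ (S : Type u) [CommRing S] [Algebra K S] (φ : R →ₐ[K] S),
    ∀ v ∈ baseChange (φ : R →+* S) toSubmodule, ∀ f ∈ I, MvPolynomial.aeval v f = 0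

theorem baseChange_id {R : Type u} [CommRing R] (M : Submodule R (ι → R)) :
    baseChange (RingHom.id R) M = M := by
  simp [baseChange]

theorem baseChange_comp {R S S' : Type u} [CommRing R] [CommRing S] [CommRing S']
    (φ : R →+* S) (ψ : S →+* S') (M : Submodule R (ι → R)) :
    baseChange ψ (baseChange φ M) = baseChange (ψ.comp φ) M := by
  apply le_antisymm
  · refine Submodule.span_le.2 ?_
    rintro _ ⟨v, hv, rfl⟩
    simp only [SetLike.mem_coe] at hv ⊢
    induction hv using Submodule.span_induction with
    | mem x hx =>
      obtain ⟨w, hw, rfl⟩ := hx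
      exact Submodule.subset_span ⟨w, hw, rfl⟩
    | zero =>
      convert Submodule.zero_mem _ using 1
      ext i; simp
    | add x y _ _ hx hy =>
      convert Submodule.add_mem _ hx hy using 1
      ext i; simp
    | smul a x _ hx =>
      convert Submodule.smul_mem _ (ψ a) hx using 1
      ext i; simp
  · refine Submodule.span_le.2 ?_
    rintro _ ⟨v, hv, rfl⟩
    exact Submodule.subset_span ⟨fun i => φ (v i), Submodule.subset_span ⟨v, hv, rfl⟩, rfl⟩

open TensorProduct in
/-- A direct summand stays a direct summand under base change, and the base change is the
tensor product. -/
theorem baseChange_aux [Finite ι] {R S : Type u} [CommRing R] [CommRing S] [Algebra R S]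
    (M : Submodule R (ι → R)) (hM : IsComplemented M) :
    IsComplemented (baseChange (algebraMap R S) M) ∧
      Nonempty (S ⊗[R] M ≃ₗ[S] baseChange (algebraMap R S) M) := by
  classical
  have := Fintype.ofFinite ι
  obtain ⟨N, hN⟩ := hM
  let r : (ι → R) →ₗ[R] M := M.projectionOnto N hN
  have hr : r ∘ₗ M.subtype = LinearMap.id := by
    ext x : 1
    exact Submodule.projectionOnto_apply_left hN x
  let e : S ⊗[R] (ι → R) ≃ₗ[S] (ι → S) := TensorProduct.piScalarRight R S S ι
  have he : ∀ (a : S) (v : ι → R), e (a ⊗ₜ v) = fun i => algebraMap R S (v i) * a := by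
    intro a v
    ext i
    simp [e, TensorProduct.piScalarRight_apply, TensorProduct.piScalarRightHom_tmul,
      Algebra.smul_def]
  let j : S ⊗[R] M →ₗ[S] (ι → S) := e.toLinearMap ∘ₗ M.subtype.baseChange S
  let r' : (ι → S) →ₗ[S] S ⊗[R] M := r.baseChange S ∘ₗ e.symm.toLinearMap
  have hrj : ∀ x, r' (j x) = x := by
    intro x
    have h1 : r' (j x) = (r.baseChange S ∘ₗ M.subtype.baseChange S) x := by simp [r', j]
    rw [h1, ← LinearMap.baseChange_comp, hr]
    simp
  have hj : Function.Injective j := Function.LeftInverse.injective hrj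
  have hrange : LinearMap.range j = baseChange (algebraMap R S) M := by
    apply le_antisymm
    · rintro _ ⟨x, rfl⟩
      induction x using TensorProduct.induction_on with
      | zero => simp
      | tmul a v =>
        have h2 : j (a ⊗ₜ v) = a • fun i => algebraMap R S ((v : ι → R) i) := by
          simp only [j, LinearMap.comp_apply, LinearMap.baseChange_tmul, LinearEquiv.coe_coe, he]
          ext i
          simp [mul_comm]
        rw [h2]
        exact Submodule.smul_mem _ _ (Submodule.subset_span ⟨v, v.2, rfl⟩)
      | add x y hx hy => rw [map_add]; exact Submodule.add_mem _ hx hy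
    · refine Submodule.span_le.2 ?_
      rintro _ ⟨v, hv, rfl⟩
      refine ⟨1 ⊗ₜ ⟨v, hv⟩, ?_⟩
      simp [j, he]
  rw [← hrange]
  refine ⟨⟨LinearMap.ker (j.rangeRestrict ∘ₗ r'), LinearMap.isCompl_of_proj ?_⟩,
    ⟨LinearEquiv.ofInjective j hj⟩⟩
  rintro ⟨_, x, rfl⟩
  ext1
  simp [hrj]

/-- Functoriality of the points of the Fano scheme: pulling back families of `k`-planes. -/
def FanoPoint.map [Finite ι] {I : Ideal (MvPolynomial ι K)} {k : ℕ} {R S : Type u} [CommRing R]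
    [CommRing S] [Algebra K R] [Algebra K S] (φ : R →ₐ[K] S) (x : FanoPoint I k R) :
    FanoPoint I k S where
  toSubmodule := baseChange (φ : R →+* S) x.toSubmodule
  isComplemented := by
    let : Algebra R S := (φ : R →+* S).toAlgebra
    exact (baseChange_aux (S := S) x.toSubmodule x.isComplemented).1
  rank_eq p := by
    let : Algebra R S := (φ : R →+* S).toAlgebra
    obtain ⟨e⟩ := (baseChange_aux (S := S) x.toSubmodule x.isComplemented).2
    have : Module.Finite R x.toSubmodule := by
      obtain ⟨N, hN⟩ := x.isComplemented
      exact Module.Finite.of_surjective _ (Submodule.projectionOnto_surjective hN)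
    have : Module.Projective R x.toSubmodule := by
      obtain ⟨N, hN⟩ := x.isComplemented
      refine Module.Projective.of_split x.toSubmodule.subtype
        (x.toSubmodule.projectionOnto N hN) ?_
      ext1 y
      exact Submodule.projectionOnto_apply_left hN y
    have h := congrFun (Module.rankAtStalk_eq_of_equiv e) p
    rw [Module.rankAtStalk_baseChange, x.rank_eq] at h
    exact h.symm
  vanishing S' _ _ ψ v hv f hf := by
    rw [baseChange_comp] at hv
    exact x.vanishing S' (ψ.comp φ) v hv f hf

theorem FanoPoint.map_id [Finite ι] {I : Ideal (MvPolynomial ι K)} {k : ℕ} {R : Type u}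
    [CommRing R] [Algebra K R] (x : FanoPoint I k R) : x.map (AlgHom.id K R) = x :=
  FanoPoint.ext (baseChange_id x.toSubmodule)

theorem FanoPoint.map_comp [Finite ι] {I : Ideal (MvPolynomial ι K)} {k : ℕ} {R S S' : Type u}
    [CommRing R] [CommRing S] [CommRing S'] [Algebra K R] [Algebra K S] [Algebra K S']
    (φ : R →ₐ[K] S) (ψ : S →ₐ[K] S') (x : FanoPoint I k R) :
    x.map (ψ.comp φ) = (x.map φ).map ψ :=
  FanoPoint.ext (baseChange_comp (φ : R →+* S) (ψ : S →+* S') x.toSubmodule).symm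

/-- The Fano scheme `F_k(X)` of `k`-planes in `X = V(I) ⊆ ℙ(K^ι)`, the fine moduli space of
`k`-planes contained in `X`, as a functor of points on `K`-algebras. -/
def fanoScheme [Finite ι] (I : Ideal (MvPolynomial ι K)) (k : ℕ) :
    CommAlgCat.{u} K ⥤ Type u where
  obj R := FanoPoint I k R
  map φ := ↾(FanoPoint.map φ.hom)
  map_id R := by
    refine ConcreteCategory.hom_ext _ _ fun x => ?_
    exact FanoPoint.map_id x
  map_comp φ ψ := by
    refine ConcreteCategory.hom_ext _ _ fun x => ?_
    exact FanoPoint.map_comp φ.hom ψ.hom x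

/-- The set of points of `ℙ(K^ι)` lying on the linear subspace given by `W ⊆ K^ι`. -/
def linearSubspace (W : Submodule K (ι → K)) : Set (Projectivization K (ι → K)) :=
  {p | p.submodule ≤ W}

/-- The Zariski closure of a set of points of `ℙ(K^ι)`: the common zeros of all forms that
vanish on the set. -/
def zariskiClosure (Z : Set (Projectivization K (ι → K))) :
    Set (Projectivization K (ι → K)) :=
  {p | ∀ (d : ℕ) (f : MvPolynomial ι K), f.IsHomogeneous d →
    (∀ q ∈ Z, MvPolynomial.eval q.rep f = 0) → MvPolynomial.eval p.rep f = 0}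

end Fano

/-! ### Lattice polytopes -/

section Polytope

variable {m : ℕ}

/-- A lattice point of `ℤ^m` viewed in `ℝ^m`. -/
def toReal (u : Fin m → ℤ) : Fin m → ℝ := fun i => (u i : ℝ)

variable (m) in
/-- An `m`-dimensional polytope in `ℝ^m` whose vertices are lattice points. -/
structure LatticePolytope where
  carrier : Set (Fin m → ℝ)
  exists_eq_convexHull : ∃ V : Finset (Fin m → ℤ),
    carrier = convexHull ℝ (toReal '' (V : Set (Fin m → ℤ)))
  affineSpan_eq_top : affineSpan ℝ carrier = ⊤

/-- The set of lattice points `P ∩ ℤ^m`. -/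
abbrev LatticePolytope.latticePoints (P : LatticePolytope m) : Set (Fin m → ℤ) :=
  {u | toReal u ∈ P.carrier}

instance (P : LatticePolytope m) : Finite P.latticePoints := by
  obtain ⟨V, hV⟩ := P.exists_eq_convexHull
  have hb : Bornology.IsBounded P.carrier := by
    rw [hV, isBounded_convexHull]
    exact (V.finite_toSet.image _).isBounded
  obtain ⟨C, hC⟩ := hb.exists_norm_le
  have hfin : (Set.Icc (fun _ => -⌈C⌉ : Fin m → ℤ) (fun _ => ⌈C⌉)).Finite := Set.finite_Icc _ _
  refine (hfin.subset fun u hu => ?_).to_subtype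
  have h : ∀ i, |(u i : ℝ)| ≤ C := fun i => (norm_le_pi_norm (toReal u) i).trans (hC _ hu)
  refine ⟨fun i => ?_, fun i => ?_⟩
  · have := (abs_le.1 (h i)).1
    have h2 := Int.le_ceil C
    have : (-⌈C⌉ : ℝ) ≤ u i := by linarith
    exact_mod_cast this
  · have := (abs_le.1 (h i)).2
    have h2 := Int.le_ceil C
    have : (u i : ℝ) ≤ ⌈C⌉ := by linarith
    exact_mod_cast this

/-- `Q` is a (nonempty) face of the polytope `P`: the set of points of `P` where some linear
functional is maximal (so `P` itself is a face). -/
def IsFace (P : LatticePolytope m) (Q : Set (Fin m → ℝ)) : Prop :=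
  IsExposed ℝ P.carrier Q ∧ Q.Nonempty

/-- `Q` is a primitive `k`-simplex: the convex hull of `k + 1` affinely independent lattice points
that contains no other lattice points. -/
def IsPrimitiveSimplex (k : ℕ) (Q : Set (Fin m → ℝ)) : Prop :=
  ∃ v : Fin (k + 1) → (Fin m → ℤ),
    AffineIndependent ℝ (fun i => toReal (v i)) ∧
    Q = convexHull ℝ (Set.range fun i => toReal (v i)) ∧
    ∀ u : Fin m → ℤ, toReal u ∈ Q → u ∈ Set.range v

end Polytope

/-! ### The projective toric variety of a lattice polytope and its torus -/

section Toric

variable {m : ℕ} (K : Type u) [Field K] (P : LatticePolytope m)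

/-- The subsemigroup `S_P` of `ℤ^m × ℤ` generated by `(P ∩ ℤ^m) × {1}`. -/
def semigroup : AddSubmonoid ((Fin m → ℤ) × ℤ) :=
  AddSubmonoid.closure ((fun u => (u, 1)) '' P.latticePoints)

/-- The generator `(u, 1)` of `S_P`, for `u ∈ P ∩ ℤ^m`. -/
def semigroupGen (u : P.latticePoints) : semigroup P :=
  ⟨((u : Fin m → ℤ), 1), AddSubmonoid.subset_closure ⟨u, u.2, rfl⟩⟩

/-- The surjection `K[x_u | u ∈ P ∩ ℤ^m] → K[S_P]`, `x_u ↦ χ^(u,1)`. -/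
noncomputable def toricHom :
    MvPolynomial P.latticePoints K →ₐ[K] AddMonoidAlgebra K (semigroup P) :=
  MvPolynomial.aeval fun u => AddMonoidAlgebra.single (semigroupGen P u) 1

/-- The homogeneous ideal `I_P` of `X_P = Proj K[S_P]` in the projective space with coordinates
`x_u`, `u ∈ P ∩ ℤ^m`: the kernel of `K[x_u] → K[S_P]`. -/
noncomputable def toricIdeal : Ideal (MvPolynomial P.latticePoints K) :=
  RingHom.ker (toricHom K P)

variable (m) in
/-- The `R`-points `(Rˣ)^m` of the torus `T = Spec K[ℤ^m]`. -/
abbrev Torus (R : Type u) [CommRing R] : Type u := Fin m → Rˣ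

/-- The value `t^u` of the character `u ∈ ℤ^m` at `t ∈ T(R)`. -/
def character {R : Type u} [CommRing R] (u : Fin m → ℤ) : Torus m R →* Rˣ where
  toFun t := ∏ i, t i ^ u i
  map_one' := by simp
  map_mul' s t := by simp [mul_zpow, Finset.prod_mul_distrib]

/-- The action of `t ∈ T(R)` on the homogeneous coordinates: `x_u` is scaled by `t^u`. -/
def torusEquiv {R : Type u} [CommRing R] (t : Torus m R) :
    (P.latticePoints → R) ≃ₗ[R] (P.latticePoints → R) :=
  LinearEquiv.piCongrRight fun u => LinearEquiv.smulOfUnit (character (u : Fin m → ℤ) t)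

variable {K P}

theorem torusEquiv_apply {R : Type u} [CommRing R] (t : Torus m R) (v : P.latticePoints → R)
    (u : P.latticePoints) :
    torusEquiv P t v u = (character (u : Fin m → ℤ) t : R) * v u := rfl

theorem character_add {R : Type u} [CommRing R] (u v : Fin m → ℤ) (t : Torus m R) :
    character (u + v) t = character u t * character v t := by
  simp [character, zpow_add, Finset.prod_mul_distrib]

theorem character_zero {R : Type u} [CommRing R] (t : Torus m R) :
    character (0 : Fin m → ℤ) t = 1 := by
  simp [character]

theorem toricHom_surjective : Function.Surjective (toricHom K P) := by
  rw [← AlgHom.range_eq_top, eq_top_iff]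
  have key : ∀ s (hs : s ∈ semigroup P),
      AddMonoidAlgebra.single (⟨s, hs⟩ : semigroup P) (1 : K) ∈ (toricHom K P).range := by
    intro s hs
    induction hs using AddSubmonoid.closure_induction with
    | mem x hx =>
      obtain ⟨u, hu, rfl⟩ := hx
      exact ⟨MvPolynomial.X ⟨u, hu⟩, by simp [toricHom, semigroupGen]⟩
    | zero => exact Subalgebra.one_mem _
    | add x y hx hy h1 h2 =>
      have := Subalgebra.mul_mem _ h1 h2
      rw [AddMonoidAlgebra.single_mul_single, one_mul] at this
      exact this
  intro f _
  induction f using AddMonoidAlgebra.induction_on with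
  | of s => exact key _ (Multiplicative.toAdd s).2
  | add f g hf hg => exact Subalgebra.add_mem _ (hf trivial) (hg trivial)
  | smul r f hf => exact Subalgebra.smul_mem _ (hf trivial) r

/-- The torus preserves `X_P`. -/
theorem aeval_torusEquiv {R : Type u} [CommRing R] [Algebra K R] (t : Torus m R)
    (v : P.latticePoints → R) (hv : ∀ f ∈ toricIdeal K P, MvPolynomial.aeval v f = 0) :
    ∀ f ∈ toricIdeal K P, MvPolynomial.aeval (torusEquiv P t v) f = 0 := by
  let ψ : AddMonoidAlgebra K (semigroup P) →ₐ[K] R :=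
    AlgHom.liftOfSurjective (toricHom K P) toricHom_surjective (MvPolynomial.aeval v) hv
  have hψ : ∀ u, ψ (AddMonoidAlgebra.single (semigroupGen P u) 1) = v u := by
    intro u
    have : ψ (toricHom K P (MvPolynomial.X u)) = MvPolynomial.aeval v (MvPolynomial.X u) :=
      AlgHom.liftOfSurjective_apply _ _ _ _ _
    simpa [toricHom] using this
  let χ : Multiplicative (semigroup P) →* R :=
    { toFun := fun s => (character (s.toAdd : (Fin m → ℤ) × ℤ).1 t : R) *
        ψ (AddMonoidAlgebra.single s.toAdd 1)
      map_one' := by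
        have : ψ (AddMonoidAlgebra.single 0 1) = 1 := map_one ψ
        simp [character_zero, this]
      map_mul' := by
        intro a b
        have : (AddMonoidAlgebra.single (a.toAdd + b.toAdd) (1 : K)) =
            AddMonoidAlgebra.single a.toAdd 1 * AddMonoidAlgebra.single b.toAdd 1 := by
          rw [AddMonoidAlgebra.single_mul_single, one_mul]
        simp only [toAdd_mul, this, map_mul, AddSubmonoid.coe_add, Prod.fst_add, character_add,
          Units.val_mul]
        ring }
  have hχ : (AddMonoidAlgebra.lift K R (semigroup P) χ).comp (toricHom K P) =
      MvPolynomial.aeval (torusEquiv P t v) := by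
    ext u
    simp [toricHom, χ, ← hψ, torusEquiv_apply, semigroupGen]
  intro f hf
  rw [← hχ, AlgHom.comp_apply, show toricHom K P f = 0 from hf, map_zero]

theorem baseChange_torusEquiv {R S : Type u} [CommRing R] [CommRing S] (φ : R →+* S)
    (t : Torus m R) (M : Submodule R (P.latticePoints → R)) :
    baseChange φ (M.map (torusEquiv P t).toLinearMap) =
      (baseChange φ M).map (torusEquiv P fun i => Units.map (φ : R →* S) (t i)).toLinearMap := by
  rw [baseChange, baseChange, Submodule.map_span]
  congr 1
  simp only [Submodule.map_coe, Set.image_image]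
  refine Set.image_congr fun v _ => ?_
  ext u
  have h : ((character (u : Fin m → ℤ) fun i => Units.map (φ : R →* S) (t i)) : Sˣ) =
      Units.map (φ : R →* S) (character (u : Fin m → ℤ) t) := by
    simp [character, map_prod, map_zpow]
  simp [torusEquiv_apply, h]

/-- The action of `T(R)` on the `R`-points of `F_k(X_P)`: the `k`-plane `L` is moved to `t · L`. -/
def torusAct {k : ℕ} {R : Type u} [CommRing R] [Algebra K R] (t : Torus m R)
    (x : FanoPoint (toricIdeal K P) k R) : FanoPoint (toricIdeal K P) k R where
  toSubmodule := x.toSubmodule.map (torusEquiv P t).toLinearMap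
  isComplemented := by
    obtain ⟨N, hN⟩ := x.isComplemented
    exact ⟨_, hN.map (Submodule.orderIsoMapComap (torusEquiv P t))⟩
  rank_eq p := by
    rw [← x.rank_eq p]
    exact congrFun (Module.rankAtStalk_eq_of_equiv ((torusEquiv P t).submoduleMap _)).symm p
  vanishing S _ _ φ v hv := by
    rw [baseChange_torusEquiv] at hv
    obtain ⟨w, hw, rfl⟩ := hv
    exact aeval_torusEquiv _ w fun f hf => x.vanishing S φ w hw f hf

/-- The actions of the groups `T(R)` are compatible with change of `R`. -/
theorem map_torusAct {k : ℕ} {R S : Type u} [CommRing R] [CommRing S] [Algebra K R] [Algebra K S]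
    (φ : R →ₐ[K] S) (t : Torus m R) (x : FanoPoint (toricIdeal K P) k R) :
    (torusAct t x).map φ =
      torusAct (fun i => Units.map ((φ : R →+* S) : R →* S) (t i)) (x.map φ) :=
  FanoPoint.ext (baseChange_torusEquiv (φ : R →+* S) t x.toSubmodule)

variable (K P)

/-- The torus fixed points of the Fano scheme `F_k(X_P)`: the `K`-points that are fixed by the
action of the group scheme `T`, i.e. by all `R`-points of `T`, for all `K`-algebras `R`. -/
def fixedPoints (k : ℕ) : Set ((fanoScheme (toricIdeal K P) k).obj (CommAlgCat.of K K)) :=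
  {x | ∀ (R : Type u) [CommRing R] [Algebra K R] (t : Torus m R),
    torusAct t (FanoPoint.map (Algebra.ofId K R) x) = FanoPoint.map (Algebra.ofId K R) x}

open Classical in
/-- The vector with coordinates `1` at the lattice points of `Q` and `0` elsewhere; for a face `Q`
of `P`, it represents a point of `X_P`. -/
noncomputable def facePoint (Q : Set (Fin m → ℝ)) : P.latticePoints → K :=
  fun u => if toReal (u : Fin m → ℤ) ∈ Q then 1 else 0

/-- The torus orbit in `X_P` corresponding to the face `Q` of `P`. -/
def faceOrbit (Q : Set (Fin m → ℝ)) : Set (Projectivization K (P.latticePoints → K)) :=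
  {p | ∃ t : Torus m K, p.submodule = Submodule.span K {torusEquiv P t (facePoint K P Q)}}

/-- The closure `X_Q` of the torus orbit corresponding to the face `Q`. -/
def faceVariety (Q : Set (Fin m → ℝ)) : Set (Projectivization K (P.latticePoints → K)) :=
  zariskiClosure (faceOrbit K P Q)

end Toric

end ToricFano

/-!
The ideal of `X_P` is spanned by binomials `x^a - x^b` with `a` and `b` of equal degree in `S_P`, so
membership in `X_P` compares monomials. Since the characters of the torus over an infinite field are
linearly independent, a torus-stable subspace contains the coordinate vectors in the support of each
of its elements, and the fixed `k`-planes are coordinate subspaces `K^A`, `A ⊆ P ∩ ℤ^m`.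

Testing the binomials on indicator vectors of subsets `B ⊆ A` shows that `K^A` lies in `X_P` if and
only if every such `B` cuts out a face of the semigroup `S_P`, that is, if and only if `A` does and
the generators `(u, 1)`, `u ∈ A`, are linearly independent: a real relation among them can be
replaced by an integral one with the same signs, and it gives two sums of generators of equal degree
with disjoint supports. A separation argument turns faces of the semigroup into faces of `P`.

Finally, every form vanishing on the orbit of a face `Q` restricts to zero on the coordinate
subspace of `Q` when its lattice points are affinely independent, since then distinct monomials of
the same degree restrict to distinct characters on the orbit. Conversely, `X_Q` satisfies the
binomials, so if it is linear it is a coordinate subspace contained in `X_P`.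
-/

namespace ToricFano

/-! ### Integral approximation of real linear relations -/

section IntegralRelations

open Filter Topology

theorem tendsto_floor_natCast_mul_div (x : ℝ) :
    Tendsto (fun N : ℕ => (⌊N * x⌋ : ℝ) / N) atTop (𝓝 x) := by
  have hlower : Tendsto (fun N : ℕ => x - 1 / (N : ℝ)) atTop (𝓝 x) := by
    simpa using tendsto_const_nhds.sub (tendsto_one_div_atTop_nhds_zero_nat (𝕜 := ℝ))
  refine tendsto_of_tendsto_of_tendsto_of_le_of_le' hlower tendsto_const_nhds ?_ ?_
  all_goals
    filter_upwards [eventually_gt_atTop 0] with N hN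
    have hN' : (0 : ℝ) < N := Nat.cast_pos.2 hN
  · rw [le_div_iff₀ hN', sub_mul, one_div_mul_cancel hN'.ne', mul_comm x]
    exact (Int.sub_one_lt_floor _).le
  · rw [div_le_iff₀ hN', mul_comm x]
    exact Int.floor_le _

theorem exists_tendsto_intLinearMap_div (E : Submodule ℤ ℝ) [Module.Finite ℤ E] :
    ∃ φ : ℕ → E →ₗ[ℤ] ℤ, ∀ x : E, Tendsto (fun N => (φ N x : ℝ) / N) atTop (𝓝 x) := by
  let b := Module.finBasis ℤ E
  refine ⟨fun N => b.constr ℤ fun j => ⌊N * (b j : ℝ)⌋, fun x => ?_⟩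
  have hx : (x : ℝ) = ∑ j, (b.repr x j : ℝ) * b j := by
    conv_lhs => rw [← b.sum_repr x]
    simp only [Submodule.coe_sum, Submodule.coe_smul, zsmul_eq_mul]
  simp only [Module.Basis.constr_apply_fintype, Module.Basis.equivFun_apply, smul_eq_mul,
    Int.cast_sum, Int.cast_mul, Finset.sum_div, mul_div_assoc]
  rw [hx]
  exact tendsto_finsetSum _ fun j _ => (tendsto_floor_natCast_mul_div _).const_mul _

theorem exists_intLinearMap_sign_eq (E : Submodule ℤ ℝ) [Module.Finite ℤ E] {s : Set E}
    (hs : s.Finite) :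
    ∃ φ : E →ₗ[ℤ] ℤ, ∀ x ∈ s, SignType.sign (φ x) = SignType.sign (x : ℝ) := by
  obtain ⟨φ, hφ⟩ := exists_tendsto_intLinearMap_div E
  suffices h : ∀ᶠ N in atTop, ∀ x ∈ s, SignType.sign (φ N x) = SignType.sign (x : ℝ) from
    let ⟨N, hN⟩ := h.exists; ⟨φ N, hN⟩
  refine (eventually_all_finite hs).2 fun x _ => ?_
  rcases eq_or_ne x 0 with rfl | hx
  · simp
  have hsign := (continuousAt_sign_of_ne_zero (ZeroMemClass.coe_eq_zero.not.2 hx)).tendsto.comp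
    (hφ x)
  rw [nhds_discrete, tendsto_pure] at hsign
  filter_upwards [hsign, eventually_gt_atTop 0] with N hN hpos
  rw [← hN, Function.comp_apply, div_eq_mul_inv, sign_mul,
    sign_pos (inv_pos.2 (Nat.cast_pos.2 hpos)), mul_one, sign_intCast]

theorem exists_finsupp_int_sign_eq {ι : Type*} (c : ι →₀ ℝ) : ∃ n : ι →₀ ℤ,
    (∀ i, SignType.sign (n i) = SignType.sign (c i)) ∧
      ∀ r : ι → ℤ, Finsupp.linearCombination ℝ (fun i => (r i : ℝ)) c = 0 →
        Finsupp.linearCombination ℤ r n = 0 := by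
  let E : Submodule ℤ ℝ := Submodule.span ℤ (Set.range c)
  have : Module.Finite ℤ E := Module.Finite.span_of_finite ℤ c.finite_range
  let c' : ι → E := fun i => ⟨c i, Submodule.subset_span ⟨i, rfl⟩⟩
  have hc' : (Set.range c').Finite :=
    (c.finite_range.preimage Subtype.val_injective.injOn).subset
      (Set.range_subset_iff.2 fun i => ⟨i, rfl⟩)
  obtain ⟨φ, hφ⟩ := exists_intLinearMap_sign_eq E hc'
  have hsign : ∀ i, SignType.sign (φ (c' i)) = SignType.sign (c i) := fun i => hφ _ ⟨i, rfl⟩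
  have hsupp : ∀ i, φ (c' i) ≠ 0 → i ∈ c.support := fun i hi => by
    rwa [Finsupp.mem_support_iff, ← sign_ne_zero, ← hsign, sign_ne_zero]
  refine ⟨Finsupp.onFinset c.support (fun i => φ (c' i)) hsupp, hsign, fun r hr => ?_⟩
  have hrel : ∑ i ∈ c.support, r i • c' i = 0 := Subtype.ext <| by
    simpa [c', Finsupp.linearCombination_apply, Finsupp.sum, mul_comm] using hr
  rw [Finsupp.linearCombination_apply, Finsupp.onFinset_sum _ (by simp), ← map_zero φ, ← hrel,
    map_sum]
  exact Finset.sum_congr rfl fun i _ => by rw [map_smul, smul_eq_mul, smul_eq_mul, mul_comm]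

end IntegralRelations

/-! ### Affine independence and separation -/

section Convex

theorem affineIndependent_iff_linearIndependent_prod {k V ι : Type*} [Ring k] [AddCommGroup V]
    [Module k V] {p : ι → V} :
    AffineIndependent k p ↔ LinearIndependent k fun i => (p i, (1 : k)) := by
  rw [affineIndependent_iff, linearIndependent_iff']
  refine forall₂_congr fun s w => ?_
  simp only [Prod.ext_iff, Prod.fst_sum, Prod.snd_sum, Prod.smul_mk, smul_eq_mul, mul_one,
    Prod.fst_zero, Prod.snd_zero, and_imp]
  exact forall_comm

theorem eq_zero_of_forall_mem_lt {𝕜 E : Type*} [Field 𝕜] [Preorder 𝕜]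
    [AddCommGroup E] [Module 𝕜 E] {W : Submodule 𝕜 E} {l : E →ₗ[𝕜] 𝕜} {a : 𝕜}
    (h : ∀ w ∈ W, a < l w) : ∀ w ∈ W, l w = 0 := by
  intro w hw
  by_contra hne
  have := h _ (W.smul_mem (a / l w) hw)
  rw [map_smul, smul_eq_mul, div_mul_cancel₀ _ hne] at this
  exact this.false

theorem exists_linearCombination_of_mem_convexHull_image {𝕜 ι E : Type*} [Field 𝕜]
    [LinearOrder 𝕜] [IsStrictOrderedRing 𝕜] [AddCommGroup E] [Module 𝕜 E] {v : ι → E} {B : Set ι}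
    {x : E} (hx : x ∈ convexHull 𝕜 (v '' B)) : ∃ c : ι →₀ 𝕜, Finsupp.linearCombination 𝕜 v c = x ∧
      (∀ i, 0 ≤ c i) ∧ (∀ i ∉ B, c i = 0) ∧ c ≠ 0 := by
  classical
  have himage : v '' B = Finsupp.linearCombination 𝕜 v '' ((fun i => Finsupp.single i 1) '' B) := by
    simp [Set.image_image]
  rw [himage, ← LinearMap.image_convexHull] at hx
  obtain ⟨c, hc, rfl⟩ := hx
  have hmin : convexHull 𝕜 ((fun i => Finsupp.single i (1 : 𝕜)) '' B) ⊆
      {c | (∀ i, 0 ≤ c i) ∧ (∀ i ∉ B, c i = 0) ∧ Finsupp.linearCombination 𝕜 1 c = (1 : 𝕜)} := by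
    refine convexHull_min ?_ ?_
    · rintro _ ⟨i, hi, rfl⟩
      refine ⟨fun j => ?_, fun j hj => Finsupp.single_eq_of_ne fun h => hj (h ▸ hi), by simp⟩
      exact Finsupp.single_nonneg.2 zero_le_one j
    · rintro c ⟨hc, hcB, hc1⟩ d ⟨hd, hdB, hd1⟩ s t hs ht hst
      refine ⟨fun i => ?_, fun i hi => by simp [hcB i hi, hdB i hi], by simp [hc1, hd1, hst]⟩
      exact add_nonneg (mul_nonneg hs (hc i)) (mul_nonneg ht (hd i))
  obtain ⟨hc, hcB, hc1⟩ := hmin hc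
  exact ⟨c, rfl, hc, hcB, fun h => by simp [h] at hc1⟩

theorem exists_strongDual_eq_zero_and_neg {ι E : Type*} [Finite ι] [NormedAddCommGroup E]
    [NormedSpace ℝ E] [FiniteDimensional ℝ E] {v : ι → E} {A : Set ι}
    (h : ∀ c : ι →₀ ℝ, Finsupp.linearCombination ℝ v c = 0 → (∀ i ∉ A, 0 ≤ c i) →
      ∀ i ∉ A, c i = 0) :
    ∃ l : StrongDual ℝ E, (∀ i ∈ A, l (v i) = 0) ∧ ∀ i ∉ A, l (v i) < 0 := by
  have hdisj : Disjoint (convexHull ℝ (v '' Aᶜ)) (Submodule.span ℝ (v '' A) : Set E) := by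
    refine Set.disjoint_left.2 fun x hx hxA => ?_
    obtain ⟨c, rfl, hc0, hcA, hc⟩ := exists_linearCombination_of_mem_convexHull_image hx
    obtain ⟨d, hd, hdc⟩ := (Finsupp.mem_span_image_iff_linearCombination ℝ).1 hxA
    have hd0 : ∀ i ∉ A, d i = 0 := fun i hi =>
      Finsupp.notMem_support_iff.1 fun h' => hi (hd h')
    have hcd := h (c - d) (by rw [map_sub, hdc, sub_self]) fun i hi => by
      simpa [hd0 i hi] using hc0 i
    refine hc (Finsupp.ext fun i => ?_)
    by_cases hi : i ∈ A
    · exact hcA i (not_not.2 hi)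
    · simpa [hd0 i hi] using hcd i hi
  obtain ⟨l, a, b, hl, hab, hb⟩ := geometric_hahn_banach_compact_closed (convex_convexHull ℝ _)
    ((Set.toFinite (v '' Aᶜ)).isCompact_convexHull (𝕜 := ℝ)) (Submodule.convex _)
    (Submodule.closed_of_finiteDimensional _) hdisj
  have hb0 : b < 0 := by simpa using hb 0 (Submodule.zero_mem _)
  refine ⟨l, fun i hi => ?_, fun i hi => ?_⟩
  · exact eq_zero_of_forall_mem_lt (l := l.toLinearMap) hb _ (Submodule.subset_span ⟨i, hi, rfl⟩)
  · exact (hl _ (subset_convexHull ℝ _ ⟨i, hi, rfl⟩)).trans (hab.trans hb0)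

end Convex

/-! ### Binomial relations in the semigroup algebra -/

section Semigroup

variable {m : ℕ} {P : LatticePolytope m}

variable (P) in
/-- The degree of a monomial in the `x_u` for the grading of `K[x_u]` by `S_P` that makes
`x_u ↦ χ^(u,1)` homogeneous. Monomials of equal degree differ by an element of the toric ideal. -/
noncomputable def expDegree : (P.latticePoints →₀ ℕ) →ₗ[ℕ] semigroup P :=
  Finsupp.linearCombination ℕ (semigroupGen P)

/-- The generator `(u, 1)` of `S_P` as a vector of `ℝ^m × ℝ`. Linear independence of these vectors
is affine independence of the lattice points `u`. -/
def realGen (u : P.latticePoints) : (Fin m → ℝ) × ℝ :=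
  (toReal u, 1)

theorem toricHom_monomial {K : Type u} [Field K] (a : P.latticePoints →₀ ℕ) (c : K) :
    toricHom K P (MvPolynomial.monomial a c) = AddMonoidAlgebra.single (expDegree P a) c := by
  have hof : ∀ u, AddMonoidAlgebra.single (semigroupGen P u) (1 : K) =
      AddMonoidAlgebra.of K _ (Multiplicative.ofAdd (semigroupGen P u)) := fun _ => rfl
  have hdeg : (a.prod fun u n => Multiplicative.ofAdd (semigroupGen P u) ^ n) =
      Multiplicative.ofAdd (expDegree P a) := rfl
  simp only [toricHom, MvPolynomial.aeval_monomial, hof, ← map_pow, ← map_finsuppProd, hdeg]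
  simp [AddMonoidAlgebra.of_apply]

theorem map_expDegree {M : Type*} [AddCommMonoid M] (f : (Fin m → ℤ) × ℤ →+ M)
    (a : P.latticePoints →₀ ℕ) :
    f (expDegree P a) = Finsupp.linearCombination ℕ (fun u : P.latticePoints => f (u, 1)) a :=
  Finsupp.apply_linearCombination ℕ (f.comp (semigroup P).subtype).toNatLinearMap _ a

theorem linearCombination_realGen_eq {a b : P.latticePoints →₀ ℕ}
    (hab : expDegree P a = expDegree P b) :
    Finsupp.linearCombination ℕ realGen a = Finsupp.linearCombination ℕ realGen b := by
  let f : (Fin m → ℤ) × ℤ →+ (Fin m → ℝ) × ℝ :=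
    ((Int.castAddHom ℝ).compLeft (Fin m)).prodMap (Int.castAddHom ℝ)
  have hf : ∀ u : P.latticePoints, f (u, 1) = realGen u := fun u =>
    Prod.ext rfl (Int.cast_one (R := ℝ))
  calc Finsupp.linearCombination ℕ realGen a = f (expDegree P a) := by
        simp only [map_expDegree, hf]
    _ = f (expDegree P b) := by rw [hab]
    _ = Finsupp.linearCombination ℕ realGen b := by simp only [map_expDegree, hf]

theorem linearCombination_toNat_sub_toNat_neg {ι M : Type*} [AddCommGroup M] (v : ι → M)
    (n : ι →₀ ℤ) :
    Finsupp.linearCombination ℕ v (n.mapRange Int.toNat rfl) -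
        Finsupp.linearCombination ℕ v ((-n).mapRange Int.toNat rfl) =
      Finsupp.linearCombination ℤ v n := by
  simp only [Finsupp.linearCombination_apply, Finsupp.sum_mapRange_index, zero_smul, implies_true]
  rw [Finsupp.sum_of_support_subset _ n.support_neg.le _ (by simp), Finsupp.sum, Finsupp.sum,
    ← Finset.sum_sub_distrib]
  refine Finset.sum_congr rfl fun i _ => ?_
  rw [Finsupp.neg_apply, ← natCast_zsmul, ← natCast_zsmul, ← sub_smul, Int.toNat_sub_toNat_neg]

theorem exists_expDegree_eq_of_linearCombination_eq_zero {c : P.latticePoints →₀ ℝ}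
    (hc : Finsupp.linearCombination ℝ realGen c = 0) :
    ∃ a b : P.latticePoints →₀ ℕ, expDegree P a = expDegree P b ∧
      (∀ u, u ∈ a.support ↔ 0 < c u) ∧ ∀ u, u ∈ b.support ↔ c u < 0 := by
  obtain ⟨n, hsign, hrel⟩ := exists_finsupp_int_sign_eq c
  refine ⟨n.mapRange Int.toNat rfl, (-n).mapRange Int.toNat rfl, ?_, fun u => ?_, fun u => ?_⟩
  · let g : P.latticePoints → (Fin m → ℤ) × ℤ := fun u => (u, 1)
    have hg : Finsupp.linearCombination ℤ g n = 0 := by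
      refine Prod.ext (funext fun j => ?_) ?_
      · refine (Finsupp.apply_linearCombination ℤ (.proj j ∘ₗ .fst ℤ _ _) g n).trans (hrel _ ?_)
        have := Finsupp.apply_linearCombination ℝ (.proj j ∘ₗ .fst ℝ _ _) realGen c
        rwa [hc, map_zero, eq_comm] at this
      · refine (Finsupp.apply_linearCombination ℤ (.snd ℤ _ _) g n).trans (hrel _ ?_)
        have := Finsupp.apply_linearCombination ℝ (.snd ℝ _ _) realGen c
        rw [hc, map_zero, eq_comm] at this
        simpa [realGen, Function.comp_def, g] using this
    rw [← linearCombination_toNat_sub_toNat_neg, sub_eq_zero] at hg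
    exact Subtype.ext ((map_expDegree (.id _) _).trans (hg.trans (map_expDegree (.id _) _).symm))
  · simp [← sign_eq_one_iff (a := c u), ← hsign u, sign_eq_one_iff]
  · simp [← sign_eq_neg_one_iff (a := c u), ← hsign u, sign_eq_neg_one_iff]

end Semigroup

/-! ### Zeros of the toric ideal -/

section ToricPoint

variable {m : ℕ} {P : LatticePolytope m} {R : Type*} [CommRing R]

/-- A vector `v ∈ R^(P ∩ ℤ^m)` satisfying the binomial equations of the cone over `X_P`: monomials
of equal degree in `S_P` take equal values at `v`. -/
def IsToricPoint (v : P.latticePoints → R) : Prop :=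
  ∀ a b : P.latticePoints →₀ ℕ, expDegree P a = expDegree P b →
    (a.prod fun u n => v u ^ n) = b.prod fun u n => v u ^ n

/-- The generators `(u, 1)`, `u ∈ A`, are those on a face of the semigroup `S_P`, in the sense that
a sum of generators involving some `u ∉ A` is never a sum of generators from `A`. -/
def IsFacial (A : Set P.latticePoints) : Prop :=
  ∀ a b : P.latticePoints →₀ ℕ, expDegree P a = expDegree P b →
    (a.support : Set P.latticePoints) ⊆ A → (b.support : Set P.latticePoints) ⊆ A

theorem monomial_sub_monomial_mem_toricIdeal {K : Type u} [Field K] {a b : P.latticePoints →₀ ℕ}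
    (hab : expDegree P a = expDegree P b) :
    MvPolynomial.monomial a 1 - MvPolynomial.monomial b 1 ∈ toricIdeal K P := by
  rw [toricIdeal, RingHom.mem_ker, map_sub, toricHom_monomial, toricHom_monomial, hab, sub_self]

theorem isToricPoint_iff {K R : Type u} [Field K] [CommRing R] [Algebra K R]
    {v : P.latticePoints → R} :
    IsToricPoint v ↔ ∀ f ∈ toricIdeal K P, MvPolynomial.aeval v f = 0 := by
  refine ⟨fun h f hf => ?_, fun h a b hab => ?_⟩
  · let ψ : semigroup P → R := Function.extend (expDegree P) (fun a => a.prod fun u n => v u ^ n) 0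
    have hψ : ∀ a, ψ (expDegree P a) = a.prod fun u n => v u ^ n := fun a =>
      Function.FactorsThrough.extend_apply (fun a b hab => h a b hab) 0 a
    let L : AddMonoidAlgebra K (semigroup P) →ₗ[K] R :=
      (Finsupp.linearCombination K ψ) ∘ₗ (AddMonoidAlgebra.coeffLinearEquiv K).toLinearMap
    have hL : L ∘ₗ (toricHom K P).toLinearMap = (MvPolynomial.aeval v).toLinearMap := by
      refine MvPolynomial.linearMap_ext fun a => ?_
      ext
      simp [L, toricHom_monomial, hψ, MvPolynomial.aeval_monomial]
    calc MvPolynomial.aeval v f = L (toricHom K P f) := (LinearMap.congr_fun hL f).symm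
      _ = 0 := by rw [show toricHom K P f = 0 from hf, map_zero]
  · simpa [MvPolynomial.aeval_monomial, sub_eq_zero] using
      h _ (monomial_sub_monomial_mem_toricIdeal hab)

theorem snd_expDegree (a : P.latticePoints →₀ ℕ) :
    (expDegree P a : (Fin m → ℤ) × ℤ).2 = a.degree :=
  (map_expDegree (.snd _ _) a).trans <| by
    simp [Finsupp.linearCombination_apply, Finsupp.sum, Finsupp.degree_apply]

theorem degree_eq_of_expDegree_eq {a b : P.latticePoints →₀ ℕ}
    (hab : expDegree P a = expDegree P b) : a.degree = b.degree := by
  exact_mod_cast (snd_expDegree a).symm.trans ((congrArg (fun s => s.1.2) hab).trans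
    (snd_expDegree b))

theorem IsToricPoint.smul {v : P.latticePoints → R} (hv : IsToricPoint v) (c : R) :
    IsToricPoint (c • v) := by
  have hprod : ∀ a : P.latticePoints →₀ ℕ,
      (a.prod fun u n => (c • v) u ^ n) = c ^ a.degree * a.prod fun u n => v u ^ n := fun a => by
    simp [Finsupp.prod, mul_pow, Finset.prod_mul_distrib, Finset.prod_pow_eq_pow_sum,
      Finsupp.degree_apply]
  intro a b hab
  rw [hprod, hprod, hv a b hab, degree_eq_of_expDegree_eq hab]

theorem prod_pow_eq_zero_of_mem_spanSubset {ι : Type*} [Finite ι] {A : Set ι} {v : ι → R}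
    (hv : v ∈ Pi.spanSubset R A) {a : ι →₀ ℕ} (ha : ¬(a.support : Set ι) ⊆ A) :
    (a.prod fun i n => v i ^ n) = 0 := by
  obtain ⟨i, hi, hiA⟩ := Set.not_subset.1 ha
  refine Finset.prod_eq_zero hi ?_
  dsimp only
  rw [Pi.mem_spanSubset_iff.1 hv i hiA, zero_pow (Finsupp.mem_support_iff.1 hi)]

theorem indicator_one_mem_spanSubset {ι : Type*} [Finite ι] {A B : Set ι} (h : B ⊆ A) :
    B.indicator (1 : ι → R) ∈ Pi.spanSubset R A :=
  Pi.mem_spanSubset_iff.2 fun _ hi => Set.indicator_of_notMem (fun hB => hi (h hB)) _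

theorem prod_indicator_one_pow {ι : Type*} {A : Set ι} {a : ι →₀ ℕ}
    (ha : (a.support : Set ι) ⊆ A) : (a.prod fun i n => A.indicator (1 : ι → R) i ^ n) = 1 :=
  Finset.prod_eq_one fun i hi => by simp [Set.indicator_of_mem (ha hi)]

theorem isToricPoint_indicator_iff [Nontrivial R] {A : Set P.latticePoints} :
    IsToricPoint (A.indicator (1 : P.latticePoints → R)) ↔ IsFacial A := by
  have hmem : A.indicator (1 : P.latticePoints → R) ∈ Pi.spanSubset R A :=
    indicator_one_mem_spanSubset le_rfl
  refine ⟨fun h a b hab ha => ?_, fun h a b hab => ?_⟩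
  · by_contra hb
    have := h a b hab
    rw [prod_indicator_one_pow ha, prod_pow_eq_zero_of_mem_spanSubset hmem hb] at this
    exact one_ne_zero this
  · by_cases ha : (a.support : Set P.latticePoints) ⊆ A
    · rw [prod_indicator_one_pow ha, prod_indicator_one_pow (h a b hab ha)]
    · rw [prod_pow_eq_zero_of_mem_spanSubset hmem ha,
        prod_pow_eq_zero_of_mem_spanSubset hmem fun hb => ha (h b a hab.symm hb)]

theorem eq_of_expDegree_eq {A : Set P.latticePoints} (hA : LinearIndepOn ℝ realGen A)
    {a b : P.latticePoints →₀ ℕ} (ha : (a.support : Set P.latticePoints) ⊆ A)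
    (hb : (b.support : Set P.latticePoints) ⊆ A) (hab : expDegree P a = expDegree P b) : a = b := by
  have hℕ : LinearIndepOn ℕ realGen A := LinearIndependent.restrict_scalars' ℕ hA
  exact linearIndepOn_iffₛ.1 hℕ a ha b hb (linearCombination_realGen_eq hab)

theorem linearIndepOn_realGen_of_isFacial {A : Set P.latticePoints}
    (h : ∀ B ⊆ A, IsFacial B) : LinearIndepOn ℝ realGen A := by
  have hnonpos : ∀ c ∈ Finsupp.supported ℝ ℝ A, Finsupp.linearCombination ℝ realGen c = 0 →
      ∀ u, c u ≤ 0 := by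
    intro c hcA hc u
    by_contra! hu
    obtain ⟨a, b, hab, ha, hb⟩ := exists_expDegree_eq_of_linearCombination_eq_zero hc
    have hbA : (b.support : Set P.latticePoints) ⊆ A \ {u} := fun w hw =>
      have hw : c w < 0 := (hb w).1 hw
      ⟨hcA (Finsupp.mem_support_iff.2 hw.ne), fun hwu => hu.not_gt (hwu ▸ hw)⟩
    exact (h _ Set.sdiff_subset b a hab.symm hbA ((ha u).2 hu)).2 rfl
  refine linearIndepOn_iff.2 fun c hcA hc => Finsupp.ext fun u => (hnonpos c hcA hc u).antisymm ?_
  simpa using hnonpos (-c) (neg_mem hcA) (by rw [map_neg, hc, neg_zero]) u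

theorem isToricPoint_of_mem_spanSubset {A : Set P.latticePoints} (hA : IsFacial A)
    (hind : LinearIndepOn ℝ realGen A) {v : P.latticePoints → R} (hv : v ∈ Pi.spanSubset R A) :
    IsToricPoint v := by
  intro a b hab
  by_cases ha : (a.support : Set P.latticePoints) ⊆ A
  · rw [eq_of_expDegree_eq hind ha (hA a b hab ha) hab]
  · rw [prod_pow_eq_zero_of_mem_spanSubset hv ha,
      prod_pow_eq_zero_of_mem_spanSubset hv fun hb => ha (hA b a hab.symm hb)]

theorem isFacial_and_linearIndepOn_of_isToricPoint [Nontrivial R] {A : Set P.latticePoints}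
    (h : ∀ v ∈ Pi.spanSubset R A, IsToricPoint v) : IsFacial A ∧ LinearIndepOn ℝ realGen A := by
  have hfacial : ∀ B ⊆ A, IsFacial B := fun B hB =>
    isToricPoint_indicator_iff.1 (h _ (indicator_one_mem_spanSubset hB))
  exact ⟨hfacial A le_rfl, linearIndepOn_realGen_of_isFacial hfacial⟩

end ToricPoint

/-! ### Faces of the polytope and faces of the semigroup -/

section Face

variable {m : ℕ} {P : LatticePolytope m}

theorem affineIndependent_toReal_iff {ι : Type*} {w : ι → P.latticePoints} :
    AffineIndependent ℝ (fun i => toReal (w i : Fin m → ℤ)) ↔ LinearIndependent ℝ (realGen ∘ w) :=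
  affineIndependent_iff_linearIndependent_prod

theorem isFacial_iff_exists_strongDual {A : Set P.latticePoints} :
    IsFacial A ↔ ∃ L : StrongDual ℝ ((Fin m → ℝ) × ℝ),
      (∀ u ∈ A, L (realGen u) = 0) ∧ ∀ u ∉ A, L (realGen u) < 0 := by
  refine ⟨fun hA => exists_strongDual_eq_zero_and_neg fun c hc hpos u hu => ?_, ?_⟩
  · obtain ⟨a, b, hab, ha, hb⟩ := exists_expDegree_eq_of_linearCombination_eq_zero hc
    have hbA : (b.support : Set P.latticePoints) ⊆ A := fun w hw => by
      by_contra hwA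
      exact (hpos w hwA).not_gt ((hb w).1 hw)
    refine ((hpos u hu).eq_or_lt.resolve_right fun hcu => hu ?_).symm
    exact hA b a hab.symm hbA ((ha u).2 hcu)
  · rintro ⟨L, hL0, hLneg⟩ a b hab ha
    have hsum : ∀ a : P.latticePoints →₀ ℕ, L (Finsupp.linearCombination ℕ realGen a) =
        ∑ u ∈ a.support, a u • L (realGen u) := fun a => by
      simp only [Finsupp.linearCombination_apply, Finsupp.sum, map_sum, map_nsmul]
    have hnonpos : ∀ u, L (realGen u) ≤ 0 := fun u => by
      by_cases hu : u ∈ A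
      exacts [(hL0 u hu).le, (hLneg u hu).le]
    have hzero : ∑ u ∈ b.support, b u • L (realGen u) = 0 := by
      rw [← hsum, ← linearCombination_realGen_eq hab, hsum]
      exact Finset.sum_eq_zero fun u hu => by rw [hL0 u (ha hu), smul_zero]
    intro u hu
    by_contra huA
    have := (Finset.sum_eq_zero_iff_of_nonpos fun w _ =>
      smul_nonpos_of_nonneg_of_nonpos (Nat.zero_le _) (hnonpos w)).1 hzero u hu
    exact (smul_ne_zero (Finsupp.mem_support_iff.1 hu) (hLneg u huA).ne) this

variable (P) in
/-- The set `Q ∩ ℤ^m` for `Q ⊆ P`, as a set of indices of the coordinates `x_u`. -/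
def latticePointsIn (Q : Set (Fin m → ℝ)) : Set P.latticePoints :=
  {u | toReal u ∈ Q}

theorem LatticePolytope.carrier_eq_convexHull (P : LatticePolytope m) :
    P.carrier = convexHull ℝ (toReal '' P.latticePoints) := by
  obtain ⟨V, hV⟩ := P.exists_eq_convexHull
  have hconvex : Convex ℝ P.carrier := hV ▸ convex_convexHull ℝ _
  refine Set.Subset.antisymm ?_ (convexHull_min (Set.image_subset_iff.2 fun u hu => hu) hconvex)
  rw [hV]
  refine convexHull_mono (Set.image_mono fun u hu => ?_)
  change toReal u ∈ P.carrier
  exact hV ▸ subset_convexHull ℝ _ ⟨u, hu, rfl⟩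

theorem LatticePolytope.convex_carrier (P : LatticePolytope m) : Convex ℝ P.carrier :=
  P.carrier_eq_convexHull ▸ convex_convexHull ℝ _

theorem LatticePolytope.isCompact_carrier (P : LatticePolytope m) : IsCompact P.carrier := by
  rw [P.carrier_eq_convexHull]
  exact ((Set.toFinite P.latticePoints).image toReal).isCompact_convexHull (𝕜 := ℝ)

namespace IsFace

variable {Q : Set (Fin m → ℝ)}

theorem subset (hQ : IsFace P Q) : Q ⊆ P.carrier :=
  hQ.1.subset

theorem isFacial (hQ : IsFace P Q) : IsFacial (latticePointsIn P Q) := by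
  obtain ⟨l, hl⟩ := hQ.1 hQ.2
  obtain ⟨q, hq⟩ := hQ.2
  have hq' := hl ▸ hq
  let L := l.coprod (ContinuousLinearMap.toSpanSingleton ℝ (-l q))
  have hL : ∀ u : P.latticePoints, L (realGen u) = l (toReal u) - l q := fun u => by
    simp [L, realGen, sub_eq_add_neg]
  refine isFacial_iff_exists_strongDual.2 ⟨L, fun u hu => ?_, fun u hu => ?_⟩
  · have hu' : toReal u ∈ Q := hu
    rw [hl] at hu'
    rw [hL, sub_eq_zero]
    exact (hq'.2 _ hu'.1).antisymm (hu'.2 q hq'.1)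
  · rw [hL, sub_neg]
    refine (hq'.2 _ u.2).lt_of_ne fun heq => hu ?_
    change toReal u ∈ Q
    rw [hl]
    exact ⟨u.2, fun y hy => heq ▸ hq'.2 y hy⟩

theorem eq_convexHull (hQ : IsFace P Q) :
    Q = convexHull ℝ ((fun u : P.latticePoints => toReal u) '' latticePointsIn P Q) := by
  have hvertices : Q.extremePoints ℝ ⊆
      (fun u : P.latticePoints => toReal u) '' latticePointsIn P Q := by
    intro x hx
    have hxP := hQ.1.isExtreme.extremePoints_subset_extremePoints hx
    rw [P.carrier_eq_convexHull] at hxP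
    obtain ⟨u, hu, rfl⟩ := extremePoints_convexHull_subset hxP
    exact ⟨⟨u, hu⟩, hx.1, rfl⟩
  refine Set.Subset.antisymm ?_ (convexHull_min (Set.image_subset_iff.2 fun u hu => hu)
    (hQ.1.convex P.convex_carrier))
  conv_lhs => rw [← closure_convexHull_extremePoints (hQ.1.isCompact P.isCompact_carrier)
    (hQ.1.convex P.convex_carrier)]
  exact closure_minimal (convexHull_mono hvertices)
    ((Set.toFinite _).isClosed_convexHull (𝕜 := ℝ))

theorem latticePointsIn_nonempty (hQ : IsFace P Q) : (latticePointsIn P Q).Nonempty := by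
  have h := hQ.2
  rwa [hQ.eq_convexHull, convexHull_nonempty_iff, Set.image_nonempty] at h

theorem isPrimitiveSimplex_iff (hQ : IsFace P Q) {d : ℕ} :
    IsPrimitiveSimplex d Q ↔
      LinearIndepOn ℝ realGen (latticePointsIn P Q) ∧ (latticePointsIn P Q).ncard = d + 1 := by
  constructor
  · rintro ⟨v, hv, rfl, hmem⟩
    have hvQ : ∀ i, toReal (v i) ∈ convexHull ℝ (Set.range fun i => toReal (v i)) := fun i =>
      subset_convexHull ℝ _ ⟨i, rfl⟩
    let w : Fin (d + 1) → P.latticePoints := fun i => ⟨v i, hQ.subset (hvQ i)⟩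
    have hw : Function.Injective w := fun i j hij =>
      hv.injective (congrArg (fun u : P.latticePoints => toReal (u : Fin m → ℤ)) hij)
    have hrange : latticePointsIn P (convexHull ℝ (Set.range fun i => toReal (v i))) =
        Set.range w := by
      refine Set.Subset.antisymm (fun u hu => ?_) (Set.range_subset_iff.2 hvQ)
      obtain ⟨i, hi⟩ := hmem u hu
      exact ⟨i, Subtype.ext hi⟩
    rw [hrange, linearIndepOn_range_iff hw, Set.ncard_range_of_injective hw, Nat.card_fin]
    exact ⟨affineIndependent_toReal_iff.1 hv, rfl⟩
  · rintro ⟨hA, hcard⟩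
    let e := (Finite.equivFinOfCardEq ((Nat.card_coe_set_eq _).trans hcard)).symm
    have hrange : Set.range (fun i => (e i : P.latticePoints)) = latticePointsIn P Q := by
      rw [← Function.comp_def, e.surjective.range_comp, Subtype.range_coe]
    refine ⟨fun i => (e i : P.latticePoints),
      affineIndependent_toReal_iff.2 (hA.comp e e.injective), ?_, fun u hu => ?_⟩
    · conv_lhs => rw [hQ.eq_convexHull, ← hrange, ← Set.range_comp]
      rfl
    · obtain ⟨i, hi⟩ := hrange.ge (show (⟨u, hQ.subset hu⟩ : P.latticePoints) ∈ _ from hu)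
      exact ⟨i, congrArg Subtype.val hi⟩

end IsFace

theorem IsFacial.exists_isFace {A : Set P.latticePoints} (hA : IsFacial A) (hne : A.Nonempty) :
    ∃ Q, IsFace P Q ∧ latticePointsIn P Q = A := by
  obtain ⟨L, hL0, hLneg⟩ := isFacial_iff_exists_strongDual.1 hA
  let l : StrongDual ℝ (Fin m → ℝ) := L ∘L .inl ℝ _ _
  have hl : ∀ u : P.latticePoints, L (realGen u) = l (toReal u) + L (0, 1) := fun u => by
    simp [l, realGen, ← map_add]
  have hmax : ∀ x ∈ P.carrier, l x ≤ -L (0, 1) := by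
    rw [P.carrier_eq_convexHull]
    refine convexHull_min ?_ (convex_halfSpace_le l.isLinear _)
    rintro _ ⟨u, hu, rfl⟩
    have hnonpos : L (realGen ⟨u, hu⟩) ≤ 0 := by
      by_cases huA : (⟨u, hu⟩ : P.latticePoints) ∈ A
      exacts [(hL0 _ huA).le, (hLneg _ huA).le]
    have h : l (toReal u) + L (0, 1) ≤ 0 := hl ⟨u, hu⟩ ▸ hnonpos
    exact le_neg_iff_add_nonpos_right.2 h
  have hattained : ∀ u ∈ A, l (toReal u) = -L (0, 1) := fun u hu =>
    eq_neg_of_add_eq_zero_left ((hl u).symm.trans (hL0 u hu))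
  have hmem : ∀ u ∈ A, toReal u ∈ l.toExposed P.carrier := fun u hu =>
    ⟨u.2, fun y hy => (hmax y hy).trans (hattained u hu).ge⟩
  obtain ⟨u₀, hu₀⟩ := hne
  refine ⟨l.toExposed P.carrier, ⟨ContinuousLinearMap.toExposed.isExposed, _, hmem u₀ hu₀⟩,
    Set.Subset.antisymm (fun u hu => ?_) hmem⟩
  by_contra huA
  have := hu.2 _ u₀.2
  rw [hattained u₀ hu₀, neg_le_iff_add_nonneg, ← hl] at this
  exact this.not_gt (hLneg u huA)

end Face

/-! ### Coordinate subspaces -/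

section SpanSubset

variable {ι R : Type*} [Finite ι] [DecidableEq ι]

theorem single_one_mem_spanSubset_iff [Semiring R] [Nontrivial R] {A : Set ι} {i : ι} :
    Pi.single i 1 ∈ Pi.spanSubset R A ↔ i ∈ A := by
  rw [Pi.mem_spanSubset_iff]
  refine ⟨fun h => by_contra fun hi => ?_, fun hi j hj => Pi.single_eq_of_ne ?_ _⟩
  · exact one_ne_zero ((Pi.single_eq_same (M := fun _ => R) i 1).symm.trans (h i hi))
  · exact fun hji => hj (hji ▸ hi)

theorem spanSubset_le_iff [Semiring R] {A : Set ι} {W : Submodule R (ι → R)} :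
    Pi.spanSubset R A ≤ W ↔ ∀ i ∈ A, Pi.single i 1 ∈ W := by
  rw [Pi.spanSubset, Submodule.span_le, Set.image_subset_iff]
  simp only [Set.subset_def, Set.mem_preimage, Pi.basisFun_apply, SetLike.mem_coe]

theorem single_one_mem_of_linearIndependent {X K : Type*} [Field K] {χ : ι → X → K}
    (hχ : LinearIndependent K χ) {W : Submodule K (ι → K)} {v : ι → K}
    (hW : ∀ x, (fun i => χ i x * v i) ∈ W) {i : ι} (hi : v i ≠ 0) : Pi.single i 1 ∈ W := by
  have := Fintype.ofFinite ι
  by_contra hiW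
  obtain ⟨g, hgi, hg⟩ := Submodule.exists_le_ker_of_notMem hiW
  have hsum : ∑ j, (g (Pi.single j 1) * v j) • χ j = 0 := by
    ext x
    calc (∑ j, (g (Pi.single j 1) * v j) • χ j) x
        = ∑ j, (χ j x * v j) • g (Pi.single j 1) := by
          simp only [Finset.sum_apply, Pi.smul_apply, smul_eq_mul]
          exact Finset.sum_congr rfl fun j _ => by ring
      _ = g fun j => χ j x * v j := by
          conv_rhs => rw [← Finset.univ_sum_single fun j => χ j x * v j, map_sum]
          refine Finset.sum_congr rfl fun j _ => ?_
          rw [← map_smul, ← Pi.single_smul, smul_eq_mul, mul_one]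
      _ = 0 := hg (hW x)
  exact mul_ne_zero hgi hi (Fintype.linearIndependent_iff.1 hχ _ hsum i)

end SpanSubset

theorem spanSubset_injective {ι : Type*} [Finite ι] (R : Type*) [Semiring R] [Nontrivial R] :
    Function.Injective (Pi.spanSubset R : Set ι → Submodule R (ι → R)) := by
  classical
  intro A B h
  ext i
  rw [← single_one_mem_spanSubset_iff (R := R), h, single_one_mem_spanSubset_iff]

theorem isCompl_spanSubset_compl {ι R : Type*} [Finite ι] [Ring R] (A : Set ι) :
    IsCompl (Pi.spanSubset R A) (Pi.spanSubset R Aᶜ) := by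
  refine ⟨(Pi.basisFun R ι).linearIndependent.disjoint_span_image disjoint_compl_right,
    codisjoint_iff.2 ?_⟩
  rw [Pi.spanSubset, Pi.spanSubset, ← Submodule.span_union, ← Set.image_union,
    Set.union_compl_self, Set.image_univ, Module.Basis.span_eq]

theorem baseChange_spanSubset {ι : Type} [Finite ι] {R S : Type u} [CommRing R] [CommRing S]
    (φ : R →+* S) (A : Set ι) : baseChange φ (Pi.spanSubset R A) = Pi.spanSubset S A := by
  classical
  refine le_antisymm (Submodule.span_le.2 ?_) (spanSubset_le_iff.2 fun i hi => ?_)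
  · rintro _ ⟨v, hv, rfl⟩
    refine Pi.mem_spanSubset_iff.2 fun i hi => ?_
    exact (congrArg φ (Pi.mem_spanSubset_iff.1 hv i hi)).trans (map_zero φ)
  · refine Submodule.subset_span ⟨Pi.single i 1, spanSubset_le_iff.1 le_rfl i hi, ?_⟩
    ext j
    simp [Pi.single_apply, apply_ite φ]

section LinearSubspace

variable {K : Type u} [Field K] {ι : Type} {W W' : Submodule K (ι → K)}

theorem mem_linearSubspace_iff_rep_mem {p : Projectivization K (ι → K)} :
    p ∈ linearSubspace W ↔ p.rep ∈ W := by
  simp only [linearSubspace, Set.mem_ofPred_eq, Projectivization.submodule_eq,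
    Submodule.span_singleton_le_iff_mem]

theorem mk_mem_linearSubspace_iff {v : ι → K} (hv : v ≠ 0) :
    Projectivization.mk K v hv ∈ linearSubspace W ↔ v ∈ W := by
  simp only [linearSubspace, Set.mem_ofPred_eq, Projectivization.submodule_mk,
    Submodule.span_singleton_le_iff_mem]

theorem linearSubspace_subset_iff : linearSubspace W ⊆ linearSubspace W' ↔ W ≤ W' := by
  refine ⟨fun h v hv => ?_, fun h p hp => le_trans hp h⟩
  by_cases hv0 : v = 0
  · exact hv0 ▸ W'.zero_mem
  · exact (mk_mem_linearSubspace_iff hv0).1 (h ((mk_mem_linearSubspace_iff hv0).2 hv))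

end LinearSubspace

/-! ### Characters of the torus -/

section Character

variable {m : ℕ} {P : LatticePolytope m} {K : Type u} [Field K]

theorem exists_zpow_ne_one [Infinite K] {n : ℤ} (hn : n ≠ 0) : ∃ x : Kˣ, x ^ n ≠ 1 := by
  classical
  obtain ⟨x, hx⟩ := Infinite.exists_notMem_finset
    (insert 0 (Polynomial.nthRootsFinset n.natAbs (1 : K)))
  rw [Finset.mem_insert, Polynomial.mem_nthRootsFinset (Int.natAbs_pos.2 hn), not_or] at hx
  refine ⟨Units.mk0 x hx.1, fun h => hx.2 ?_⟩
  exact congrArg Units.val (pow_natAbs_eq_one.2 h)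

theorem character_injective [Infinite K] :
    Function.Injective (character : (Fin m → ℤ) → Torus m K →* Kˣ) := by
  intro u v h
  ext i
  by_contra hne
  obtain ⟨x, hx⟩ := exists_zpow_ne_one (K := K) (sub_ne_zero.2 hne)
  have hmulSingle : ∀ w : Fin m → ℤ, character w (Pi.mulSingle i x : Torus m K) = x ^ w i :=
    fun w => (Fintype.prod_eq_single i fun j hj => by simp [Pi.mulSingle_eq_of_ne hj]).trans
      (by rw [Pi.mulSingle_eq_same])
  refine hx ?_
  rw [zpow_sub, ← hmulSingle, ← hmulSingle, h, mul_inv_cancel]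

variable (m K) in
theorem linearIndependent_character [Infinite K] :
    LinearIndependent K fun (u : Fin m → ℤ) (t : Torus m K) => (character u t : K) := by
  refine (linearIndependent_monoidHom (Torus m K) K).comp
    (fun u => (Units.coeHom K).comp (character u)) fun u v h => character_injective (K := K) ?_
  exact MonoidHom.ext fun t => Units.ext (DFunLike.congr_fun h t)

theorem prod_torusEquiv_pow {R : Type u} [CommRing R] (t : Torus m R) (v : P.latticePoints → R)
    (a : P.latticePoints →₀ ℕ) :
    (a.prod fun u n => torusEquiv P t v u ^ n) =
      character (expDegree P a : (Fin m → ℤ) × ℤ).1 t * a.prod fun u n => v u ^ n := by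
  let f : (Fin m → ℤ) × ℤ →+ Additive Rˣ :=
    AddMonoidHom.mk' (fun s => .ofMul (character s.1 t)) fun s s' => by
      rw [Prod.fst_add, character_add, ofMul_mul]
  have hf : character (expDegree P a : (Fin m → ℤ) × ℤ).1 t =
      a.prod fun u n => character (u : Fin m → ℤ) t ^ n := map_expDegree f a
  simp only [torusEquiv_apply, mul_pow, hf, Finsupp.prod, Units.coe_prod,
    Units.val_pow_eq_pow_val, Finset.prod_mul_distrib]

theorem torusEquiv_mem_spanSubset_iff {R : Type u} [CommRing R] {t : Torus m R}
    {A : Set P.latticePoints} {v : P.latticePoints → R} :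
    torusEquiv P t v ∈ Pi.spanSubset R A ↔ v ∈ Pi.spanSubset R A := by
  simp only [Pi.mem_spanSubset_iff, torusEquiv_apply, Units.mul_right_eq_zero]

theorem map_torusEquiv_spanSubset {R : Type u} [CommRing R] (t : Torus m R)
    (A : Set P.latticePoints) :
    (Pi.spanSubset R A).map (torusEquiv P t).toLinearMap = Pi.spanSubset R A := by
  ext v
  rw [Submodule.mem_map_equiv, ← torusEquiv_mem_spanSubset_iff (t := t),
    LinearEquiv.apply_symm_apply]

theorem spanSubset_support_le [Infinite K] {W : Submodule K (P.latticePoints → K)}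
    {v : P.latticePoints → K} (hW : ∀ t : Torus m K, torusEquiv P t v ∈ W) :
    Pi.spanSubset K (Function.support v) ≤ W := by
  classical
  exact spanSubset_le_iff.2 fun u hu => single_one_mem_of_linearIndependent
    ((linearIndependent_character m K).comp _ Subtype.val_injective) hW hu

theorem exists_eq_spanSubset [Infinite K] {W : Submodule K (P.latticePoints → K)}
    (hW : ∀ t : Torus m K, W.map (torusEquiv P t).toLinearMap = W) :
    ∃ A : Set P.latticePoints, W = Pi.spanSubset K A := by
  classical
  have horbit : ∀ v ∈ W, ∀ t : Torus m K, torusEquiv P t v ∈ W := fun v hv t =>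
    hW t ▸ Submodule.mem_map_of_mem hv
  refine ⟨⋃ v ∈ W, Function.support v, le_antisymm (fun v hv => ?_) ?_⟩
  · refine Pi.mem_spanSubset_iff.2 fun u hu => by_contra fun hvu => hu ?_
    exact Set.mem_biUnion hv hvu
  · refine spanSubset_le_iff.2 fun u hu => ?_
    obtain ⟨v, hv, hvu⟩ := Set.mem_iUnion₂.1 hu
    exact spanSubset_le_iff.1 (spanSubset_support_le (horbit v hv)) u hvu

end Character

/-! ### Closures of torus orbits -/

section HomogeneousEval

variable {ι K : Type*} [Field K] {f : MvPolynomial ι K} {d : ℕ}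

theorem eval_smul_of_isHomogeneous (hf : f.IsHomogeneous d) (c : K) (v : ι → K) :
    MvPolynomial.eval (c • v) f = c ^ d * MvPolynomial.eval v f := by
  simp only [MvPolynomial.eval_eq, Finset.mul_sum, Pi.smul_apply, smul_eq_mul, mul_pow,
    Finset.prod_mul_distrib, Finset.prod_pow_eq_pow_sum]
  refine Finset.sum_congr rfl fun a ha => ?_
  rw [hf.degree_eq_sum_deg_support ha]
  exact mul_left_comm _ _ _

theorem eval_rep_eq_zero_iff (hf : f.IsHomogeneous d) {p : Projectivization K (ι → K)}
    {v : ι → K} (hp : p.submodule = K ∙ v) :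
    MvPolynomial.eval p.rep f = 0 ↔ MvPolynomial.eval v f = 0 := by
  rw [Projectivization.submodule_eq, Submodule.span_singleton_eq_span_singleton] at hp
  obtain ⟨c, rfl⟩ := hp
  rw [Units.smul_def, eval_smul_of_isHomogeneous hf, mul_eq_zero_iff_left (by simp)]

end HomogeneousEval

section OrbitClosure

variable {K : Type u} [Field K] {m : ℕ} {P : LatticePolytope m} {Q : Set (Fin m → ℝ)}
  {p : Projectivization K (P.latticePoints → K)}

theorem facePoint_eq_indicator : facePoint K P Q = (latticePointsIn P Q).indicator 1 := by
  classical
  ext u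
  simp [facePoint, latticePointsIn, Set.indicator_apply]

theorem torusEquiv_facePoint_mem_spanSubset (t : Torus m K) :
    torusEquiv P t (facePoint K P Q) ∈ Pi.spanSubset K (latticePointsIn P Q) :=
  torusEquiv_mem_spanSubset_iff.2
    (by
    rw [facePoint_eq_indicator]; exact indicator_one_mem_spanSubset Set.Subset.rfl)

theorem support_facePoint : Function.support (facePoint K P Q) = latticePointsIn P Q := by
  rw [facePoint_eq_indicator, Set.support_indicator, Function.support_one, Set.inter_univ]

theorem faceVariety_subset_linearSubspace :
    faceVariety K P Q ⊆ linearSubspace (Pi.spanSubset K (latticePointsIn P Q)) := by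
  refine fun p hp => mem_linearSubspace_iff_rep_mem.2 (Pi.mem_spanSubset_iff.2 fun u hu => ?_)
  have hX := MvPolynomial.isHomogeneous_X K u
  rw [← MvPolynomial.eval_X (f := p.rep)]
  refine hp 1 _ hX fun q ⟨t, ht⟩ => ?_
  rw [eval_rep_eq_zero_iff hX ht, MvPolynomial.eval_X]
  exact Pi.mem_spanSubset_iff.1 (torusEquiv_facePoint_mem_spanSubset t) u hu

theorem linearIndepOn_character_expDegree [Infinite K] {A : Set P.latticePoints}
    (hA : LinearIndepOn ℝ realGen A) (d : ℕ) :
    LinearIndepOn K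
      (fun a (t : Torus m K) => (character (expDegree P a : (Fin m → ℤ) × ℤ).1 t : K))
      {a | (a.support : Set P.latticePoints) ⊆ A ∧ a.degree = d} := by
  have hinj : Set.InjOn (fun a => (expDegree P a : (Fin m → ℤ) × ℤ).1)
      {a | (a.support : Set P.latticePoints) ⊆ A ∧ a.degree = d} := fun a ha b hb hab => by
    refine eq_of_expDegree_eq hA ha.1 hb.1 (Subtype.ext (Prod.ext hab ?_))
    rw [snd_expDegree, snd_expDegree, ha.2, hb.2]
  exact (linearIndependent_character m K).comp _ hinj.injective

theorem eval_eq_zero_of_forall_torus [Infinite K] {A : Set P.latticePoints}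
    (hA : LinearIndepOn ℝ realGen A) {d : ℕ} {f : MvPolynomial P.latticePoints K}
    (hf : f.IsHomogeneous d)
    (h : ∀ t : Torus m K, MvPolynomial.eval (torusEquiv P t (A.indicator 1)) f = 0)
    {v : P.latticePoints → K} (hv : v ∈ Pi.spanSubset K A) : MvPolynomial.eval v f = 0 := by
  classical
  let s : Finset (P.latticePoints →₀ ℕ) := {a ∈ f.support | (a.support : Set P.latticePoints) ⊆ A}
  have hs : (s : Set (P.latticePoints →₀ ℕ)) ⊆
      {a | (a.support : Set P.latticePoints) ⊆ A ∧ a.degree = d} := fun a ha =>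
    have ⟨haf, haA⟩ := Finset.mem_filter.1 ha
    ⟨haA, (hf.degree_eq_sum_deg_support haf).symm⟩
  have heval : ∀ w ∈ Pi.spanSubset K A, MvPolynomial.eval w f =
      ∑ a ∈ s, f.coeff a * a.prod fun u n => w u ^ n := fun w hw => by
    rw [MvPolynomial.eval_eq]
    refine (Finset.sum_filter_of_ne fun a _ ha => ?_).symm
    by_contra haA
    exact ha (mul_eq_zero_of_right _ (prod_pow_eq_zero_of_mem_spanSubset hw haA))
  have hsum : ∑ a ∈ s, f.coeff a •
      (fun t : Torus m K => (character (expDegree P a : (Fin m → ℤ) × ℤ).1 t : K)) = 0 := by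
    ext t
    have hmem : torusEquiv P t (A.indicator 1) ∈ Pi.spanSubset K A :=
      torusEquiv_mem_spanSubset_iff.2 (indicator_one_mem_spanSubset Set.Subset.rfl)
    rw [Pi.zero_apply, ← h t, heval _ hmem, Finset.sum_apply]
    refine Finset.sum_congr rfl fun a ha => ?_
    rw [prod_torusEquiv_pow, prod_indicator_one_pow (hs ha).1, mul_one, Pi.smul_apply, smul_eq_mul]
  have hind := (linearIndepOn_character_expDegree (K := K) hA d).mono hs
  have hcoeff : ∀ a ∈ s, f.coeff a = 0 :=
    linearIndepOn_finset_iff.1 hind (fun a => f.coeff a) hsum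
  rw [heval v hv]
  exact Finset.sum_eq_zero fun a ha => by rw [hcoeff a ha, zero_mul]

namespace IsFace

theorem torusEquiv_facePoint_ne_zero (hQ : IsFace P Q) (t : Torus m K) :
    torusEquiv P t (facePoint K P Q) ≠ 0 := by
  rw [(torusEquiv P t).map_ne_zero_iff, ← Function.support_nonempty_iff, support_facePoint]
  exact hQ.latticePointsIn_nonempty

theorem isToricPoint_facePoint (hQ : IsFace P Q) : IsToricPoint (facePoint K P Q) := by
  rw [facePoint_eq_indicator]
  exact isToricPoint_indicator_iff.2 hQ.isFacial

theorem forall_mem_faceOrbit_iff (hQ : IsFace P Q) {d : ℕ} {f : MvPolynomial P.latticePoints K}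
    (hf : f.IsHomogeneous d) : (∀ q ∈ faceOrbit K P Q, MvPolynomial.eval q.rep f = 0) ↔
      ∀ t, MvPolynomial.eval (torusEquiv P t (facePoint K P Q)) f = 0 := by
  refine ⟨fun h t => ?_, fun h q ⟨t, ht⟩ => (eval_rep_eq_zero_iff hf ht).2 (h t)⟩
  have hmk := Projectivization.submodule_mk (K := K) _ (hQ.torusEquiv_facePoint_ne_zero t)
  exact (eval_rep_eq_zero_iff hf hmk).1 (h _ ⟨t, hmk⟩)

theorem isToricPoint_rep (hQ : IsFace P Q) (hp : p ∈ faceVariety K P Q) : IsToricPoint p.rep := by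
  intro a b hab
  have hf : (MvPolynomial.monomial a (1 : K) - MvPolynomial.monomial b 1).IsHomogeneous a.degree :=
    (MvPolynomial.isHomogeneous_monomial _ rfl).sub
      (MvPolynomial.isHomogeneous_monomial _ (degree_eq_of_expDegree_eq hab).symm)
  have hp' := hp _ _ hf ((hQ.forall_mem_faceOrbit_iff hf).2 fun t => ?_)
  · simpa [MvPolynomial.eval_monomial, sub_eq_zero] using hp'
  · exact aeval_torusEquiv t _ (isToricPoint_iff.1 hQ.isToricPoint_facePoint) _
      (monomial_sub_monomial_mem_toricIdeal hab)

theorem faceVariety_eq_linearSubspace [Infinite K] (hQ : IsFace P Q)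
    (hA : LinearIndepOn ℝ realGen (latticePointsIn P Q)) :
    faceVariety K P Q = linearSubspace (Pi.spanSubset K (latticePointsIn P Q)) := by
  refine faceVariety_subset_linearSubspace.antisymm fun p hp d f hf hfQ => ?_
  rw [hQ.forall_mem_faceOrbit_iff hf, facePoint_eq_indicator] at hfQ
  exact eval_eq_zero_of_forall_torus hA hf hfQ (mem_linearSubspace_iff_rep_mem.1 hp)

theorem eq_spanSubset_of_faceVariety_eq [Infinite K] (hQ : IsFace P Q)
    {W : Submodule K (P.latticePoints → K)} (hW : faceVariety K P Q = linearSubspace W) :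
    W = Pi.spanSubset K (latticePointsIn P Q) := by
  refine (linearSubspace_subset_iff.1 (hW ▸ faceVariety_subset_linearSubspace)).antisymm ?_
  rw [← support_facePoint (K := K)]
  refine spanSubset_support_le fun t => ?_
  have h0 := hQ.torusEquiv_facePoint_ne_zero t
  rw [← mk_mem_linearSubspace_iff h0, ← hW]
  exact fun _ _ _ hf => hf _ ⟨t, Projectivization.submodule_mk _ h0⟩

theorem linearIndepOn_of_faceVariety_eq [Infinite K] (hQ : IsFace P Q)
    {W : Submodule K (P.latticePoints → K)} (hW : faceVariety K P Q = linearSubspace W) :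
    LinearIndepOn ℝ realGen (latticePointsIn P Q) := by
  refine (isFacial_and_linearIndepOn_of_isToricPoint (R := K) fun v hv => ?_).2
  rw [← hQ.eq_spanSubset_of_faceVariety_eq hW] at hv
  by_cases h0 : v = 0
  · simpa [h0] using (hQ.isToricPoint_facePoint (K := K)).smul 0
  · obtain ⟨c, hc⟩ := Projectivization.exists_smul_eq_mk_rep K v h0
    have hmem := (mk_mem_linearSubspace_iff h0).2 hv
    rw [← inv_smul_smul c v, hc]
    exact (hQ.isToricPoint_rep (hW ▸ hmem)).smul _

end IsFace
end OrbitClosure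

/-! ### Fixed points of the Fano scheme -/

section FixedPoint

variable {K : Type u} [Field K] {m : ℕ} {P : LatticePolytope m} {k : ℕ}

theorem mem_fixedPoints_of_eq_spanSubset {x : FanoPoint (toricIdeal K P) k K}
    {A : Set P.latticePoints} (hx : x.toSubmodule = Pi.spanSubset K A) : x ∈ fixedPoints K P k := by
  intro R _ _ t
  refine FanoPoint.ext ?_
  change (baseChange _ x.toSubmodule).map _ = baseChange _ x.toSubmodule
  rw [hx, baseChange_spanSubset, map_torusEquiv_spanSubset]

theorem exists_eq_spanSubset_of_mem_fixedPoints [Infinite K]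
    {x : FanoPoint (toricIdeal K P) k K} (hx : x ∈ fixedPoints K P k) :
    ∃ A : Set P.latticePoints, x.toSubmodule = Pi.spanSubset K A := by
  refine exists_eq_spanSubset fun t => ?_
  have h : (baseChange (algebraMap K K) x.toSubmodule).map (torusEquiv P t).toLinearMap =
      baseChange (algebraMap K K) x.toSubmodule := congrArg FanoPoint.toSubmodule (hx K t)
  rwa [Algebra.algebraMap_self, baseChange_id] at h

theorem exists_isFace_of_mem_fixedPoints [Infinite K] {x : FanoPoint (toricIdeal K P) k K}
    (hx : x ∈ fixedPoints K P k) : ∃ Q, IsFace P Q ∧ IsPrimitiveSimplex k Q ∧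
      x.toSubmodule = Pi.spanSubset K (latticePointsIn P Q) := by
  obtain ⟨A, hA⟩ := exists_eq_spanSubset_of_mem_fixedPoints hx
  have hcard : A.ncard = k + 1 := by
    rw [← x.rank_eq ⊥, hA, Module.rankAtStalk_eq_finrank_of_free, Pi.natCast_apply,
      Pi.dim_spanSubset]
    rfl
  have htoric : ∀ v ∈ Pi.spanSubset K A, IsToricPoint v := fun v hv => by
    refine isToricPoint_iff.2 (x.vanishing K (AlgHom.id K K) v ?_)
    rwa [hA, baseChange_spanSubset]
  obtain ⟨hfacial, hind⟩ := isFacial_and_linearIndepOn_of_isToricPoint htoric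
  obtain ⟨Q, hQ, rfl⟩ := hfacial.exists_isFace (Set.nonempty_of_ncard_ne_zero (by omega))
  exact ⟨Q, hQ, hQ.isPrimitiveSimplex_iff.2 ⟨hind, hcard⟩, hA⟩

/-- The `K`-point of the Fano scheme `F_k(X_P)` given by a face `Q` that is a primitive
`k`-simplex: the `k`-plane spanned by the coordinate vectors at the lattice points of `Q`. -/
noncomputable def faceFanoPoint (K : Type u) [Field K] {Q : Set (Fin m → ℝ)} (hQ : IsFace P Q)
    (hk : IsPrimitiveSimplex k Q) : FanoPoint (toricIdeal K P) k K where
  toSubmodule := Pi.spanSubset K (latticePointsIn P Q)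
  isComplemented := ⟨_, isCompl_spanSubset_compl _⟩
  rank_eq p := by
    rw [Module.rankAtStalk_eq_finrank_of_free, Pi.natCast_apply, Pi.dim_spanSubset]
    exact (hQ.isPrimitiveSimplex_iff.1 hk).2
  vanishing S _ _ φ v hv := by
    rw [baseChange_spanSubset] at hv
    exact isToricPoint_iff.1
      (isToricPoint_of_mem_spanSubset hQ.isFacial (hQ.isPrimitiveSimplex_iff.1 hk).1 hv)

variable (K P k) in
/-- The bijection between the faces of `P` that are primitive `k`-simplices and the torus fixed
points of the Fano scheme, sending `Q` to the `k`-plane of `Q`. -/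
noncomputable def primitiveFaceEquivFixedPoints [Infinite K] :
    {Q : Set (Fin m → ℝ) // IsFace P Q ∧ IsPrimitiveSimplex k Q} ≃ fixedPoints K P k :=
  Equiv.ofBijective
    (fun Q => ⟨faceFanoPoint K Q.2.1 Q.2.2, mem_fixedPoints_of_eq_spanSubset rfl⟩) <| by
    refine ⟨fun Q Q' h => Subtype.ext ?_, fun x => ?_⟩
    · have hspan := congrArg FanoPoint.toSubmodule (congrArg Subtype.val h)
      rw [Q.2.1.eq_convexHull, Q'.2.1.eq_convexHull, spanSubset_injective K hspan]
    · obtain ⟨Q, hQ, hk, hx⟩ := exists_isFace_of_mem_fixedPoints x.2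
      exact ⟨⟨Q, hQ, hk⟩, Subtype.ext (FanoPoint.ext hx.symm)⟩

end FixedPoint

end ToricFano

theorem mainTheorem3_general {K : Type u} [Field K] [Infinite K] {m : ℕ}
    (P : ToricFano.LatticePolytope m) (k : ℕ) :
    (∃ e : {Q : Set (Fin m → ℝ) // ToricFano.IsFace P Q ∧ ToricFano.IsPrimitiveSimplex k Q} ≃
        ToricFano.fixedPoints K P k,
      ∀ Q, ToricFano.linearSubspace (e Q).1.toSubmodule = ToricFano.faceVariety K P Q.1) ∧
    ∀ Q : Set (Fin m → ℝ), ToricFano.IsFace P Q →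
      ((∃ W : Submodule K (P.latticePoints → K),
          ToricFano.faceVariety K P Q = ToricFano.linearSubspace W) ↔
        ∃ d, ToricFano.IsPrimitiveSimplex d Q) ∧
      ∀ d : ℕ, (∃ W : Submodule K (P.latticePoints → K), Module.finrank K W = d + 1 ∧
          ToricFano.faceVariety K P Q = ToricFano.linearSubspace W) ↔
        ToricFano.IsPrimitiveSimplex d Q := by
  open ToricFano in
  refine ⟨⟨primitiveFaceEquivFixedPoints K P k, fun Q => ?_⟩, fun Q hQ => ⟨⟨?_, ?_⟩, fun d => ?_⟩⟩
  · exact (Q.2.1.faceVariety_eq_linearSubspace (Q.2.1.isPrimitiveSimplex_iff.1 Q.2.2).1).symm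
  · rintro ⟨W, hW⟩
    obtain ⟨d, hd⟩ := Nat.exists_eq_add_one.2 hQ.latticePointsIn_nonempty.ncard_pos
    exact ⟨d, hQ.isPrimitiveSimplex_iff.2 ⟨hQ.linearIndepOn_of_faceVariety_eq hW, hd⟩⟩
  · rintro ⟨d, hd⟩
    exact ⟨_, hQ.faceVariety_eq_linearSubspace (hQ.isPrimitiveSimplex_iff.1 hd).1⟩
  · rw [hQ.isPrimitiveSimplex_iff, ← Pi.dim_spanSubset (R := K)]
    constructor
    · rintro ⟨W, hd, hW⟩
      exact ⟨hQ.linearIndepOn_of_faceVariety_eq hW, hQ.eq_spanSubset_of_faceVariety_eq hW ▸ hd⟩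
    · exact fun ⟨hA, hd⟩ => ⟨_, hd, hQ.faceVariety_eq_linearSubspace hA⟩

theorem mainTheorem3 {K : Type u} [Field K] [IsAlgClosed K] {m : ℕ}
    (P : ToricFano.LatticePolytope m) (k : ℕ) :
    (∃ e : {Q : Set (Fin m → ℝ) // ToricFano.IsFace P Q ∧ ToricFano.IsPrimitiveSimplex k Q} ≃
        ToricFano.fixedPoints K P k,
      ∀ Q, ToricFano.linearSubspace (e Q).1.toSubmodule = ToricFano.faceVariety K P Q.1) ∧
    ∀ Q : Set (Fin m → ℝ), ToricFano.IsFace P Q →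
      ((∃ W : Submodule K (P.latticePoints → K),
          ToricFano.faceVariety K P Q = ToricFano.linearSubspace W) ↔
        ∃ d, ToricFano.IsPrimitiveSimplex d Q) ∧
      ∀ d : ℕ, (∃ W : Submodule K (P.latticePoints → K), Module.finrank K W = d + 1 ∧
          ToricFano.faceVariety K P Q = ToricFano.linearSubspace W) ↔
        ToricFano.IsPrimitiveSimplex d Q := by
  have : Infinite K := IsAlgClosed.instInfinite
  exact mainTheorem3_general P k
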